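/- For $\lambda>0$ let $E_\lambda(z)=\sum_{n\ge 0} z^n/\Gamma(\lambda n+1)$ be the Mittag-Leffler function, and for $\sigma,\tau\in\mathbb R$, $\eta_1,\eta_2\in\mathbb C$ and $p,q>0$ put $$B_{p,q}^{\lambda;\sigma,\tau}(\eta_1,\eta_2)=\int_0^1 t^{\eta_1-1}(1-t)^{\eta_2-1}\,E_\lambda\!\left(-\frac{p}{t^\sigma}\right)E_\lambda\!\left(-\frac{q}{(1-t)^\tau}\right)dt .$$ Let $r,s\in\mathbb C$ satisfy $\Re r>0$, $\Re s>0$, $\Re(\eta_1+\sigma r)>0$, $\Re(\eta_2+\tau s)>0$, and suppose that either $0<\lambda<2$, $\Re r<1$ and $\Re s<1$, or $\lambda=1$. Then the integral defining $B_{p,q}^{\lambda;\sigma,\tau}(\eta_1,\eta_2)$ converges absolutely for all $p,q>0$, the function $(p,q)\mapsto p^{r-1}q^{s-1}B_{p,q}^{\lambda;\sigma,\tau}(\eta_1,\eta_2)$ is absolutely integrable on $(0,\infty)^2$, and $$\int_0^\infty\!\!\int_0^\infty p^{r-1}q^{s-1}\,B_{p,q}^{\lambda;\sigma,\tau}(\eta_1,\eta_2)\,dp\,dq=\frac{\pi^2}{\sin(\pi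 r)\,\sin(\pi s)\,\Gamma(1-r\lambda)\,\Gamma(1-s\lambda)}\;B(\eta_1+\sigma r,\;\eta_2+\tau s),$$ where $B(x,y)=\int_0^1t^{x-1}(1-t)^{y-1}\,dt$ is the classical beta function and $1/\Gamma$ is taken to be $0$ at the poles of $\Gamma$. In the case $\lambda=1$ the right-hand side is read, for integer $r$ or $s$, as its continuous extension; that is, for $\lambda=1$ the double integral equals $\Gamma(r)\Gamma(s)\,B(\eta_1+\sigma r,\eta_2+\tau s)$ for all $r,s$ as above. -/

import Mathlib

/-- The classical Mittag-Leffler function `E_lam(z) = ∑ zⁿ / Γ(lam n + 1)`. -/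
noncomputable def mittagLeffler (lam : ℝ) (z : ℂ) : ℂ :=
  ∑' n : ℕ, z ^ n / Complex.Gamma ((lam : ℂ) * n + 1)

/-- The function of `t` under the integral sign of the extended beta function, for `0 < t < 1`. -/
noncomputable def extBetaIntegrand (lam σ τ : ℝ) (p q η₁ η₂ : ℂ) (t : ℝ) : ℂ :=
  (t : ℂ) ^ (η₁ - 1) * ((1 - t : ℝ) : ℂ) ^ (η₂ - 1) *
    mittagLeffler lam (-p / ((t ^ σ : ℝ) : ℂ)) *
    mittagLeffler lam (-q / (((1 - t) ^ τ : ℝ) : ℂ))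

/-- The extended beta function `B_{p,q}^{lam;σ,τ}(η₁, η₂)`. -/
noncomputable def extBeta (lam σ τ : ℝ) (p q η₁ η₂ : ℂ) : ℂ :=
  ∫ t in (0 : ℝ)..1, extBetaIntegrand lam σ τ p q η₁ η₂ t

/-! For fixed t, rescaling p and q in the double integral produces t^{σr} and (1-t)^{τs} times the
Mellin transforms of x ↦ E_λ(-x) at r and s. These powers only shift the exponents of the beta
integral, so Fubini (`integrable_triple`, `double_mellin`) reduces everything to that one Mellin
transform.

For λ = 1 it is Euler's integral for Γ. For 0 < λ < 2, Γ(s)Γ(1-s) = π/sin(πs) decays like exp(-π|Im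
s|), while 1/Γ(1-λs) grows at most like exp(πλ|Im s|/2) times a polynomial, so `mlKernel` is
integrable on vertical lines avoiding its poles. Moving the line Re s = 1/2 to the left, the pole at
s = -n contributes the n-th term of E_λ(-x) (`mlKernel_vertical_integral_step`), and the remaining
integral tends to 0 (`tendsto_mlKernel_vertical_integral`). Hence E_λ(-x) is the inverse Mellin
transform of `mlKernel`, and Fourier inversion (`mellin_mellinInv_eq`) recovers the kernel. The same
representation on each line Re s = a, 0 < a < 1, bounds E_λ(-x) by a multiple of x^{-a}, which gives
the absolute convergence. -/

namespace ExtBeta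

open Complex MeasureTheory Set Filter Topology
open scoped FourierTransform

/-! ### Growth of 1/Γ and of the sine on vertical lines -/

/-- The quotient `‖Γ (x + iy)‖ / Γ x` is at least its value for `x = 1/2`, when `1/2 ≤ x`. -/
theorem Gamma_mul_norm_Gamma_half_le {x : ℝ} (hx : 1 / 2 ≤ x) (y : ℝ) :
    Real.Gamma x * ‖Gamma (1 / 2 + y * I)‖ ≤ ‖Gamma (x + y * I)‖ * Real.Gamma (1 / 2) := by
  -- Euler's product reduces the claim to one factor: |u + j + iy| / (u + j) decreases in u > 0, so
  -- it is largest at u = 1/2.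
  have key : ∀ᶠ n : ℕ in atTop, ‖GammaSeq x n‖ * ‖GammaSeq (1 / 2 + y * I) n‖ ≤
      ‖GammaSeq (x + y * I) n‖ * ‖GammaSeq ((1 / 2 : ℝ) : ℂ) n‖ := by
    filter_upwards [eventually_gt_atTop 0] with n hn
    have hn' : (0 : ℝ) < n := by exact_mod_cast hn
    have hp : ∀ z : ℂ, ‖(n : ℂ) ^ z‖ = (n : ℝ) ^ z.re := fun z => by
      rw [← ofReal_natCast, norm_cpow_eq_rpow_re_of_pos hn']
    simp only [GammaSeq, norm_div, norm_mul, hp, norm_prod]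
    have e1 : (1 / 2 + (y : ℂ) * I).re = 1 / 2 := by simp
    have e2 : ((x : ℂ) + (y : ℂ) * I).re = x := by simp
    rw [e1, e2, ofReal_re, ofReal_re, div_mul_div_comm, div_mul_div_comm,
      ← Finset.prod_mul_distrib, ← Finset.prod_mul_distrib]
    have hne : ∀ (u v : ℝ) (j : ℕ), 0 < u → 0 < ‖(u : ℂ) + v * I + j‖ := by
      intro u v j hu
      rw [norm_pos_iff]
      intro h
      have := congrArg re h
      simp at this
      have := j.cast_nonneg (α := ℝ)
      linarith
    refine div_le_div_of_nonneg_left (by positivity) ?_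
      (Finset.prod_le_prod (fun _ _ => by positivity) fun j hj => ?_)
    · refine Finset.prod_pos fun j _ => mul_pos (hne x y j (by linarith)) ?_
      simpa using hne (1 / 2) 0 j (by norm_num)
    · have a1 : ‖(x : ℂ) + j‖ = x + j := by
        rw [← ofReal_natCast, ← ofReal_add, norm_real, Real.norm_of_nonneg (by positivity)]
      have a2 : ‖((1 / 2 : ℝ) : ℂ) + j‖ = 1 / 2 + j := by
        rw [← ofReal_natCast, ← ofReal_add, norm_real, Real.norm_of_nonneg (by positivity)]
      have a3 : ∀ u : ℝ, ‖(u : ℂ) + y * I + j‖ ^ 2 = (u + j) ^ 2 + y ^ 2 := fun u => by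
        rw [← normSq_eq_norm_sq, normSq_apply]
        simp
        ring
      have a4 := a3 (1 / 2)
      push_cast at a4
      rw [a1, a2]
      refine (sq_le_sq₀ (by positivity) (by positivity)).1 ?_
      rw [mul_pow, mul_pow, a3, a4]
      have : (1 / 2 + (j : ℝ)) ^ 2 ≤ (x + j) ^ 2 := by gcongr
      nlinarith [sq_nonneg y]
  have hl : ∀ u : ℂ, Tendsto (fun n => ‖GammaSeq u n‖) atTop (𝓝 ‖Gamma u‖) :=
    fun u => (GammaSeq_tendsto_Gamma u).norm
  have := le_of_tendsto_of_tendsto ((hl x).mul (hl _)) ((hl _).mul (hl ((1 / 2 : ℝ) : ℂ))) key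
  rwa [Gamma_ofReal, Gamma_ofReal, norm_real, norm_real,
    Real.norm_of_nonneg (Real.Gamma_pos_of_pos (by linarith)).le,
    Real.norm_of_nonneg (Real.Gamma_pos_of_pos (by norm_num)).le] at this

theorem norm_Gamma_half_sq (y : ℝ) :
    ‖Gamma (1 / 2 + y * I)‖ ^ 2 = Real.pi / Real.cosh (Real.pi * y) := by
  have h := Gamma_mul_Gamma_one_sub (1 / 2 + y * I)
  have e : 1 - (1 / 2 + y * I) = (starRingEnd ℂ) (1 / 2 + y * I) := by
    apply Complex.ext <;> simp
    norm_num
  have e2 : sin (Real.pi * (1 / 2 + y * I)) = (Real.cosh (Real.pi * y) : ℝ) := by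
    rw [mul_add, mul_one_div, add_comm, sin_add_pi_div_two, ← mul_assoc, cos_mul_I]
    push_cast
    rfl
  rw [e, Gamma_conj, mul_conj, normSq_eq_norm_sq, e2] at h
  exact_mod_cast h

/-- The reciprocal of the Gamma function grows at most like `exp (π |y| / 2)` on vertical lines. -/
theorem norm_inv_Gamma_le_div {z : ℂ} (hz : 1 / 2 ≤ z.re) :
    ‖(Gamma z)⁻¹‖ ≤ Real.exp (Real.pi / 2 * |z.im|) / Real.Gamma z.re := by
  have h := Gamma_mul_norm_Gamma_half_le hz z.im
  rw [re_add_im] at h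
  have hG : 0 < Real.Gamma z.re := Real.Gamma_pos_of_pos (by linarith)
  have hzne : 0 < ‖Gamma z‖ := norm_pos_iff.2 (Gamma_ne_zero_of_re_pos (by linarith))
  have h2 : Real.exp (-(Real.pi / 2 * |z.im|)) * √Real.pi ≤ ‖Gamma (1 / 2 + z.im * I)‖ := by
    refine (sq_le_sq₀ (by positivity) (by positivity)).1 ?_
    rw [norm_Gamma_half_sq, mul_pow, Real.sq_sqrt Real.pi_pos.le, ← Real.exp_nat_mul,
      le_div_iff₀ (Real.cosh_pos _), ← Real.cosh_abs, abs_mul, abs_of_pos Real.pi_pos]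
    have : Real.cosh (Real.pi * |z.im|) ≤ Real.exp (Real.pi * |z.im|) := by
      rw [Real.cosh_eq]
      have : Real.exp (-(Real.pi * |z.im|)) ≤ Real.exp (Real.pi * |z.im|) :=
        Real.exp_le_exp.2 (by linarith [mul_nonneg Real.pi_pos.le (abs_nonneg z.im)])
      linarith
    calc _ ≤ Real.exp ((2 : ℕ) * -(Real.pi / 2 * |z.im|)) * Real.pi *
          Real.exp (Real.pi * |z.im|) := by gcongr
      _ = Real.pi * Real.exp ((2 : ℕ) * -(Real.pi / 2 * |z.im|) + Real.pi * |z.im|) := by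
          rw [Real.exp_add]; ring
      _ ≤ Real.pi := by push_cast; ring_nf; simp
  rw [Real.Gamma_one_half_eq] at h
  have h3 : Real.Gamma z.re * Real.exp (-(Real.pi / 2 * |z.im|)) ≤ ‖Gamma z‖ := by
    refine le_of_mul_le_mul_right ?_ (Real.sqrt_pos.2 Real.pi_pos)
    refine le_trans ?_ h
    rw [mul_assoc]
    gcongr
  rw [Real.exp_neg, ← div_eq_mul_inv, div_le_iff₀ (Real.exp_pos _)] at h3
  rw [norm_inv, inv_le_iff_one_le_mul₀ hzne, div_mul_eq_mul_div, le_div_iff₀ hG]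
  linarith

/-- Three uses of Γ(z+1) = zΓ(z) move the real part to at least 2, where Γ is increasing and at
least 1; each costs a factor at most ‖z‖ + 2. -/
theorem norm_inv_Gamma_le {z : ℂ} (hz : -1 ≤ z.re) :
    ‖(Gamma z)⁻¹‖ ≤ (‖z‖ + 2) ^ 3 * Real.exp (Real.pi / 2 * |z.im|) := by
  rw [one_div_Gamma_eq_self_mul_one_div_Gamma_add_one z,
    one_div_Gamma_eq_self_mul_one_div_Gamma_add_one (z + 1),
    one_div_Gamma_eq_self_mul_one_div_Gamma_add_one (z + 1 + 1)]
  have h := norm_inv_Gamma_le_div (z := z + 1 + 1 + 1) (by simp; linarith)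
  have hG : 1 ≤ Real.Gamma (z + 1 + 1 + 1).re := by
    rw [← Real.Gamma_two]
    refine Real.Gamma_strictMonoOn_Ici.monotoneOn (by simp) ?_ ?_ <;> simp <;> linarith
  have h' := h.trans (div_le_self (Real.exp_pos _).le hG)
  have e : (z + 1 + 1 + 1).im = z.im := by simp
  rw [e] at h'
  rw [norm_mul, norm_mul, norm_mul]
  have n1 : ‖z + 1‖ ≤ ‖z‖ + 1 := by simpa using norm_add_le z 1
  have n2 : ‖z + 1 + 1‖ ≤ ‖z + 1‖ + 1 := by simpa using norm_add_le (z + 1) 1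
  calc _ ≤ (‖z‖ + 2) * ((‖z‖ + 2) * ((‖z‖ + 2) * Real.exp (Real.pi / 2 * |z.im|))) := by
        gcongr <;> linarith
    _ = _ := by ring

theorem normSq_sin (z : ℂ) : ‖sin z‖ ^ 2 = Real.sin z.re ^ 2 + Real.sinh z.im ^ 2 := by
  conv_lhs => rw [← re_add_im z, sin_add_mul_I, ← ofReal_sin, ← ofReal_cosh, ← ofReal_cos,
    ← ofReal_sinh, ← ofReal_mul, ← ofReal_mul, ← normSq_eq_norm_sq, normSq_add_mul_I]
  have := Real.cosh_sq z.im
  have := Real.sin_sq_add_cos_sq z.re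
  nlinarith

/-- Since sin² + sinh² ≥ sin²·cosh², this is useful on a vertical line avoiding the zeros of the
sine. `exp_le_norm_sin` instead needs height, but is uniform in the real part. -/
theorem sin_mul_exp_le_norm_sin (z : ℂ) :
    |Real.sin z.re| * Real.exp |z.im| ≤ 2 * ‖sin z‖ := by
  have h1 : |Real.sin z.re| * Real.cosh z.im ≤ ‖sin z‖ := by
    refine (sq_le_sq₀ (by positivity) (by positivity)).1 ?_
    rw [normSq_sin, mul_pow, sq_abs, Real.cosh_sq]
    nlinarith [Real.sin_sq_le_one z.re, sq_nonneg (Real.sinh z.im)]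
  have h2 : Real.exp |z.im| ≤ 2 * Real.cosh z.im := by
    rw [← Real.cosh_abs, Real.cosh_eq]
    linarith [Real.exp_pos (-|z.im|)]
  nlinarith [abs_nonneg (Real.sin z.re)]

theorem exp_le_norm_sin {z : ℂ} (hz : 1 ≤ |z.im|) : Real.exp |z.im| ≤ 4 * ‖sin z‖ := by
  have h1 : Real.sinh |z.im| ≤ ‖sin z‖ := by
    refine (sq_le_sq₀ (Real.sinh_nonneg_iff.2 (abs_nonneg _)) (by positivity)).1 ?_
    rw [normSq_sin, ← Real.abs_sinh, sq_abs]
    nlinarith [sq_nonneg (Real.sin z.re)]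
  rw [Real.sinh_eq] at h1
  have : Real.exp (-|z.im|) ≤ 1 := Real.exp_le_one_iff.2 (by linarith)
  have : 2 ≤ Real.exp |z.im| := by linarith [Real.add_one_le_exp |z.im|]
  linarith

/-! ### Contour shifts and a residue in vertical strips -/

/-- If `f` is holomorphic in a vertical strip and decays like `1 / |im|` there, then its symmetric
vertical integrals along the two sides agree in the limit. -/
theorem tendsto_vertical_integral_sub {f : ℂ → ℂ} {a b : ℝ} (hab : a ≤ b)
    (hf : DifferentiableOn ℂ f (re ⁻¹' Icc a b)) {C : ℝ}
    (hC : ∀ s : ℂ, a ≤ s.re → s.re ≤ b → 1 ≤ |s.im| → ‖f s‖ ≤ C / |s.im|) :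
    Tendsto (fun T : ℝ => (∫ t in (-T)..T, f (b + t * I)) - ∫ t in (-T)..T, f (a + t * I))
      atTop (𝓝 0) := by
  have hlim : Tendsto (fun T : ℝ => 2 * (C * |b - a|) / T) atTop (𝓝 0) :=
    tendsto_const_nhds.div_atTop tendsto_id
  refine squeeze_zero_norm' ?_ hlim
  filter_upwards [eventually_ge_atTop 1] with T hT
  -- Cauchy on the rectangle of height 2T: the horizontal sides have fixed length and integrand
  -- O(1/T).
  have hrect := integral_boundary_rect_eq_zero_of_differentiableOn f (a + (-T : ℝ) * I) (b + T * I)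
    (hf.mono fun z hz => by
      have := hz.1
      simpa [uIcc_of_le hab] using this)
  simp only [add_re, ofReal_re, mul_re, I_re, mul_zero, ofReal_im, I_im, mul_one, sub_self,
    add_zero, add_im, mul_im, zero_add, smul_eq_mul] at hrect
  have hbd : ∀ v : ℝ, |v| = T → ‖∫ x in a..b, f (x + v * I)‖ ≤ C * |b - a| / T := fun v hv => by
    have := intervalIntegral.norm_integral_le_of_norm_le_const (a := a) (b := b) (C := C / T)
      (f := fun x : ℝ => f (x + v * I)) (fun x hx => by
        rw [uIoc_of_le hab] at hx
        have := hC (x + v * I) (by simpa using hx.1.le) (by simpa using hx.2)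
          (by simpa [hv] using hT)
        simpa [hv] using this)
    exact this.trans (by rw [div_mul_eq_mul_div])
  have h1 := hbd (-T) (by rw [abs_neg, abs_of_nonneg (by linarith)])
  have h2 := hbd T (abs_of_nonneg (by linarith))
  have e : (∫ t in (-T)..T, f (b + t * I)) - ∫ t in (-T)..T, f (a + t * I) =
      I * ((∫ x in a..b, f (x + (-T : ℝ) * I)) - ∫ x in a..b, f (x + T * I)) := by
    linear_combination (-I) * hrect + ((∫ t in (-T)..T, f (b + t * I)) -
      ∫ t in (-T)..T, f (a + t * I)) * I_sq
  rw [e, norm_mul, norm_I, one_mul]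
  refine (norm_sub_le _ _).trans ?_
  calc _ ≤ C * |b - a| / T + C * |b - a| / T := add_le_add h1 h2
    _ = _ := by ring

theorem vertical_integral_eq {f : ℂ → ℂ} {a b : ℝ} (hab : a ≤ b)
    (hf : DifferentiableOn ℂ f (re ⁻¹' Icc a b)) {C : ℝ}
    (hC : ∀ s : ℂ, a ≤ s.re → s.re ≤ b → 1 ≤ |s.im| → ‖f s‖ ≤ C / |s.im|)
    (ha : Integrable fun t : ℝ => f (a + t * I)) (hb : Integrable fun t : ℝ => f (b + t * I)) :
    ∫ t : ℝ, f (b + t * I) = ∫ t : ℝ, f (a + t * I) := by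
  have h1 := intervalIntegral_tendsto_integral ha tendsto_neg_atTop_atBot tendsto_id
  have h2 := intervalIntegral_tendsto_integral hb tendsto_neg_atTop_atBot tendsto_id
  exact sub_eq_zero.1
    (tendsto_nhds_unique (h2.sub h1) (tendsto_vertical_integral_sub hab hf hC))

/-- The integrand is the difference of 1/w on the lines Re w = ±1/2, so this is the residue of 1/w
at 0. -/
theorem integral_inv_quarter_add_sq :
    (Integrable fun t : ℝ => (1 / 4 + t ^ 2)⁻¹) ∧ ∫ t : ℝ, (1 / 4 + t ^ 2)⁻¹ = 2 * Real.pi := by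
  have e : (fun t : ℝ => (1 / 4 + t ^ 2)⁻¹) = fun t : ℝ => 4 * (1 + (2 * t) ^ 2)⁻¹ := by
    funext t
    field_simp
    ring
  rw [e]
  refine ⟨(integrable_inv_one_add_sq.comp_mul_left' two_ne_zero).const_mul 4, ?_⟩
  rw [integral_const_mul, Measure.integral_comp_mul_left (fun t : ℝ => (1 + t ^ 2)⁻¹),
    integral_univ_inv_one_add_sq, abs_of_pos (by norm_num), smul_eq_mul]
  ring

/-- The residue theorem for `F w / w` in the strip `|re w| ≤ 1 / 2`. -/
theorem vertical_integral_sub_eq_residue {F : ℂ → ℂ}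
    (hF : DifferentiableOn ℂ F (re ⁻¹' Ioo (-1) 1)) {C : ℝ}
    (hC : ∀ s : ℂ, |s.re| ≤ 1 / 2 → 1 ≤ |s.im| → ‖F s / s‖ ≤ C / |s.im|)
    (hr : Integrable fun t : ℝ => F ((1 / 2 : ℝ) + t * I) / ((1 / 2 : ℝ) + t * I))
    (hl : Integrable fun t : ℝ => F ((-(1 / 2) : ℝ) + t * I) / ((-(1 / 2) : ℝ) + t * I)) :
    (∫ t : ℝ, F ((1 / 2 : ℝ) + t * I) / ((1 / 2 : ℝ) + t * I)) -
      ∫ t : ℝ, F ((-(1 / 2) : ℝ) + t * I) / ((-(1 / 2) : ℝ) + t * I) = 2 * Real.pi * F 0 := by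
  have hne : ∀ (u : ℝ) (t : ℝ), u ≠ 0 → (u : ℂ) + t * I ≠ 0 := fun u t hu h => hu (by
    simpa using congrArg re h)
  have hsl : ∀ s : ℂ, s ≠ 0 → dslope F 0 s = F s / s - F 0 * s⁻¹ := fun s hs => by
    rw [dslope_of_ne _ hs, slope_def_field]
    ring
  have hopen : re ⁻¹' Ioo (-1 : ℝ) 1 ∈ 𝓝 (0 : ℂ) :=
    (isOpen_Ioo.preimage continuous_re).mem_nhds (by simp)
  -- Subtracting F(0)/w removes the pole: `dslope F 0` is holomorphic in the strip, and only F(0)/w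
  -- contributes to the difference.
  have hlim := tendsto_vertical_integral_sub (f := dslope F 0) (a := -(1 / 2)) (b := 1 / 2)
    (by norm_num) (((differentiableOn_dslope hopen).2 hF).mono
      (preimage_mono (Icc_subset_Ioo (by norm_num) (by norm_num)))) (C := C + ‖F 0‖)
    (fun s h1 h2 h3 => by
      have h0 : s ≠ 0 := by
        rintro rfl
        norm_num at h3
      rw [hsl s h0, add_div]
      refine (norm_sub_le _ _).trans (add_le_add (hC s (abs_le.2 ⟨h1, h2⟩) h3) ?_)
      rw [norm_mul, norm_inv, ← div_eq_mul_inv]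
      gcongr
      exact abs_im_le_norm s)
  obtain ⟨hqi, hq⟩ := integral_inv_quarter_add_sq
  have hq' : Integrable fun t : ℝ => F 0 * (((1 / 4 + t ^ 2)⁻¹ : ℝ) : ℂ) :=
    hqi.ofReal.const_mul _
  have hint := (hr.sub hl).sub hq'
  have hlim2 := intervalIntegral_tendsto_integral hint tendsto_neg_atTop_atBot tendsto_id
  have hcont : ∀ u : ℝ, u ∈ Ioo (-1 : ℝ) 1 →
      Continuous fun t : ℝ => dslope F 0 ((u : ℂ) + t * I) := fun u hu => by
    have h := ((differentiableOn_dslope hopen).2 hF).continuousOn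
    exact h.comp_continuous (by fun_prop) (fun t => by simpa using hu)
  have heq : ∀ T : ℝ, (∫ t in (-T)..T, dslope F 0 ((1 / 2 : ℝ) + t * I)) -
      (∫ t in (-T)..T, dslope F 0 ((-(1 / 2) : ℝ) + t * I)) =
      ∫ t in (-T)..T, (F ((1 / 2 : ℝ) + t * I) / ((1 / 2 : ℝ) + t * I) -
        F ((-(1 / 2) : ℝ) + t * I) / ((-(1 / 2) : ℝ) + t * I)) -
        F 0 * (((1 / 4 + t ^ 2)⁻¹ : ℝ) : ℂ) := fun T => by
    rw [← intervalIntegral.integral_sub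
      ((hcont _ (by norm_num)).intervalIntegrable _ _)
      ((hcont _ (by norm_num)).intervalIntegrable _ _)]
    refine intervalIntegral.integral_congr fun t _ => ?_
    have n1 := hne (1 / 2) t (by norm_num)
    have n2 := hne (-(1 / 2)) t (by norm_num)
    have e : ((1 / 2 : ℝ) + t * I : ℂ)⁻¹ - ((-(1 / 2) : ℝ) + t * I : ℂ)⁻¹ =
        (((1 / 4 + t ^ 2)⁻¹ : ℝ) : ℂ) := by
      have n3 : ((1 / 4 + t ^ 2 : ℝ) : ℂ) ≠ 0 := by
        have : (0 : ℝ) < 1 / 4 + t ^ 2 := by positivity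
        exact_mod_cast this.ne'
      rw [inv_sub_inv n1 n2, ofReal_inv, div_eq_iff (mul_ne_zero n1 n2), eq_comm,
        inv_mul_eq_iff_eq_mul₀ n3]
      push_cast
      linear_combination (t : ℂ) ^ 2 * I_sq
    simp only [hsl _ n1, hsl _ n2]
    rw [← e]
    ring
  have h0 := tendsto_nhds_unique hlim2 (hlim.congr heq)
  have h1 := integral_sub (hr.sub hl) hq'
  have h2 := integral_sub hr hl
  simp only [Pi.sub_apply] at h0 h1 h2
  rw [h1, h2, integral_const_mul, integral_complex_ofReal, hq, sub_eq_zero] at h0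
  rw [h0]
  push_cast
  ring

/-! ### Bounds and integrability of the kernel -/

/-- The Mellin transform of `x ↦ E_lam (-x)`. -/
noncomputable def mlKernel (lam : ℝ) (s : ℂ) : ℂ :=
  Gamma s * Gamma (1 - s) * (Gamma (1 - lam * s))⁻¹

/-- This is v⁵/5! ≤ exp v at v = (A + 2u)δ/2. Of the five powers, three come from
`norm_inv_Gamma_le` and two pay for the weight 1 + (Im s)². -/
theorem pow_five_mul_exp_neg_le {A δ u : ℝ} (hA : 0 ≤ A) (hδ : 0 < δ) (hu : 0 ≤ u) :
    (A + 2 * u) ^ 5 * Real.exp (-(δ * u)) ≤ 120 * (2 / δ) ^ 5 * Real.exp (A * δ / 2) := by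
  have h := Real.pow_div_factorial_le_exp ((A + 2 * u) * (δ / 2)) (by positivity) 5
  have e : ((5 : ℕ).factorial : ℝ) = 120 := by norm_num [Nat.factorial]
  rw [e, div_le_iff₀ (by norm_num), mul_pow] at h
  have e2 : Real.exp ((A + 2 * u) * (δ / 2)) = Real.exp (A * δ / 2) * Real.exp (δ * u) := by
    rw [← Real.exp_add]; ring_nf
  rw [e2] at h
  rw [Real.exp_neg, ← div_eq_mul_inv, div_le_iff₀ (Real.exp_pos _), div_pow]
  have h5 : 0 < (δ / 2) ^ 5 := by positivity
  rw [← le_div_iff₀ h5] at h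
  refine h.trans (le_of_eq ?_)
  field_simp

/-- Here λ < 2 is decisive: the net exponential rate is π(1 - λ/2) > 0. The restriction Re s ≤ 1
keeps Re(1 - λs) ≥ -1. -/
theorem exists_norm_inv_Gamma_mul_exp_le {lam : ℝ} (h0 : 0 < lam) (h2 : lam < 2) {R : ℝ}
    (hR : 0 ≤ R) : ∃ C : ℝ, 0 ≤ C ∧ ∀ s : ℂ, |s.re| ≤ R → s.re ≤ 1 →
      ‖(Gamma (1 - lam * s))⁻¹‖ * Real.exp (-(Real.pi * |s.im|)) ≤ C / (1 + s.im ^ 2) := by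
  have hπ := Real.pi_pos
  set δ := Real.pi * (1 - lam / 2) with hδ
  have hδ0 : 0 < δ := mul_pos hπ (by linarith)
  refine ⟨120 * (2 / δ) ^ 5 * Real.exp ((3 + 2 * R) * δ / 2), by positivity, fun s hs hs1 => ?_⟩
  have hz : -1 ≤ (1 - lam * s).re := by
    simp
    nlinarith
  have hG := norm_inv_Gamma_le hz
  have him : |(1 - lam * s).im| = lam * |s.im| := by
    simp [abs_mul, abs_of_pos h0]
  rw [him] at hG
  have hn : ‖1 - lam * s‖ + 2 ≤ 3 + 2 * R + 2 * |s.im| := by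
    have t1 := norm_sub_le 1 ((lam : ℂ) * s)
    rw [norm_mul, norm_real, Real.norm_of_nonneg h0.le, norm_one] at t1
    have t2 := norm_le_abs_re_add_abs_im s
    have t3 : lam * ‖s‖ ≤ 2 * (R + |s.im|) := by gcongr; linarith
    linarith
  have hu := abs_nonneg s.im
  have h1 : 1 + s.im ^ 2 ≤ (3 + 2 * R + 2 * |s.im|) ^ 2 := by
    rw [← sq_abs s.im]
    nlinarith
  rw [le_div_iff₀ (by positivity)]
  refine le_trans ?_ (pow_five_mul_exp_neg_le (A := 3 + 2 * R) (u := |s.im|) (by positivity) hδ0 hu)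
  calc _ ≤ (3 + 2 * R + 2 * |s.im|) ^ 3 * Real.exp (Real.pi / 2 * (lam * |s.im|)) *
        Real.exp (-(Real.pi * |s.im|)) * (3 + 2 * R + 2 * |s.im|) ^ 2 := by
        gcongr
        exact hG.trans (by gcongr)
    _ = (3 + 2 * R + 2 * |s.im|) ^ 5 * (Real.exp (Real.pi / 2 * (lam * |s.im|)) *
        Real.exp (-(Real.pi * |s.im|))) := by ring
    _ = _ := by rw [← Real.exp_add, hδ]; ring_nf

theorem norm_mlKernel (lam : ℝ) (s : ℂ) :
    ‖mlKernel lam s‖ = Real.pi / ‖sin (Real.pi * s)‖ * ‖(Gamma (1 - lam * s))⁻¹‖ := by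
  rw [mlKernel, Gamma_mul_Gamma_one_sub, norm_mul, norm_div, norm_real,
    Real.norm_of_nonneg Real.pi_pos.le]

theorem norm_mlKernel_le_of_sin_ne_zero (lam : ℝ) {s : ℂ} (hs : Real.sin (Real.pi * s.re) ≠ 0) :
    ‖mlKernel lam s‖ ≤ 2 * Real.pi / |Real.sin (Real.pi * s.re)| *
      (‖(Gamma (1 - lam * s))⁻¹‖ * Real.exp (-(Real.pi * |s.im|))) := by
  have h := sin_mul_exp_le_norm_sin (Real.pi * s)
  have e1 : ((Real.pi : ℂ) * s).re = Real.pi * s.re := by simp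
  have e2 : |((Real.pi : ℂ) * s).im| = Real.pi * |s.im| := by
    simp [abs_mul, abs_of_pos Real.pi_pos]
  rw [e1, e2] at h
  have hp : 0 < |Real.sin (Real.pi * s.re)| := abs_pos.2 hs
  have hn : 0 < ‖sin (Real.pi * s)‖ := by
    have := mul_pos hp (Real.exp_pos (Real.pi * |s.im|))
    linarith
  rw [norm_mlKernel, mul_comm ‖_‖ (Real.exp _), ← mul_assoc]
  gcongr
  rw [Real.exp_neg, ← div_eq_mul_inv, div_div, div_le_div_iff₀ hn (by positivity)]
  have := Real.pi_pos
  nlinarith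

theorem norm_mlKernel_le_of_one_le_abs_im (lam : ℝ) {s : ℂ} (hs : 1 ≤ |s.im|) :
    ‖mlKernel lam s‖ ≤ 4 * Real.pi *
      (‖(Gamma (1 - lam * s))⁻¹‖ * Real.exp (-(Real.pi * |s.im|))) := by
  have e2 : |((Real.pi : ℂ) * s).im| = Real.pi * |s.im| := by
    simp [abs_mul, abs_of_pos Real.pi_pos]
  have h := exp_le_norm_sin (z := Real.pi * s) (by rw [e2]; nlinarith [Real.pi_gt_three])
  rw [e2] at h
  have hn : 0 < ‖sin (Real.pi * s)‖ := by
    have := (Real.exp_pos (Real.pi * |s.im|))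
    linarith
  rw [norm_mlKernel, mul_comm ‖_‖ (Real.exp _), ← mul_assoc]
  gcongr
  rw [Real.exp_neg, ← div_eq_mul_inv, div_le_div_iff₀ hn (by positivity)]
  have := Real.pi_pos
  nlinarith

/-- The value 0 of `Gamma` at its poles, together with `0⁻¹ = 0`, makes the reciprocal entire. -/
theorem differentiable_inv_Gamma_one_sub (lam : ℝ) :
    Differentiable ℂ fun s : ℂ => (Gamma (1 - lam * s))⁻¹ :=
  differentiable_one_div_Gamma.comp (f := fun s : ℂ => 1 - lam * s) (by fun_prop)

theorem norm_ofReal_cpow_neg_le {x : ℝ} (hx : 0 < x) {R : ℝ} {s : ℂ} (hs : |s.re| ≤ R) :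
    ‖(x : ℂ) ^ (-s)‖ ≤ Real.exp (R * |Real.log x|) := by
  rw [norm_cpow_eq_rpow_re_of_pos hx, Real.rpow_def_of_pos hx, Real.exp_le_exp, neg_re]
  refine (le_abs_self _).trans ?_
  rw [abs_mul, abs_neg, mul_comm]
  gcongr

theorem exists_norm_mlKernel_strip_le {lam : ℝ} (h0 : 0 < lam) (h2 : lam < 2) {x : ℝ} (hx : 0 < x)
    {R : ℝ} (hR : 0 ≤ R) : ∃ C : ℝ, ∀ s : ℂ, |s.re| ≤ R → s.re ≤ 1 → 1 ≤ |s.im| →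
      ‖(x : ℂ) ^ (-s) * mlKernel lam s‖ ≤ C / |s.im| := by
  obtain ⟨C, hC0, hC⟩ := exists_norm_inv_Gamma_mul_exp_le h0 h2 hR
  refine ⟨Real.exp (R * |Real.log x|) * (4 * Real.pi * C), fun s h1 h3 h4 => ?_⟩
  have hπ := Real.pi_pos
  have : C / (1 + s.im ^ 2) ≤ C / |s.im| := by
    have : 0 < |s.im| := by linarith
    gcongr
    rw [← sq_abs]
    nlinarith
  rw [norm_mul, mul_div_assoc, mul_div_assoc]
  gcongr
  · exact norm_ofReal_cpow_neg_le hx h1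
  · refine (norm_mlKernel_le_of_one_le_abs_im lam h4).trans ?_
    gcongr
    exact (hC s h1 h3).trans this

theorem mlKernel_eq_sin (lam : ℝ) (s : ℂ) :
    mlKernel lam s = Real.pi / sin (Real.pi * s) * (Gamma (1 - lam * s))⁻¹ := by
  rw [mlKernel, Gamma_mul_Gamma_one_sub]

theorem continuous_mlKernel_vertical (lam : ℝ) {a : ℝ} (ha : Real.sin (Real.pi * a) ≠ 0) :
    Continuous fun t : ℝ => mlKernel lam (a + t * I) := by
  simp only [mlKernel_eq_sin]
  refine Continuous.mul (Continuous.div₀ (by fun_prop) (by fun_prop) fun t h => ha ?_)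
    ((differentiable_inv_Gamma_one_sub lam).continuous.comp
      (f := fun t : ℝ => (a : ℂ) + t * I) (by fun_prop))
  have h' := normSq_sin (Real.pi * (a + t * I))
  rw [h] at h'
  simp at h'
  nlinarith [sq_nonneg (Real.sin (Real.pi * a)), sq_nonneg (Real.sinh (Real.pi * t))]

theorem integrable_mlKernel_vertical {lam : ℝ} (h0 : 0 < lam) (h2 : lam < 2) {a : ℝ} (ha1 : a < 1)
    (ha : Real.sin (Real.pi * a) ≠ 0) : Integrable fun t : ℝ => mlKernel lam (a + t * I) := by
  obtain ⟨C, hC0, hC⟩ := exists_norm_inv_Gamma_mul_exp_le h0 h2 (abs_nonneg a)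
  refine (integrable_inv_one_add_sq.const_mul (2 * Real.pi / |Real.sin (Real.pi * a)| * C)).mono'
    (continuous_mlKernel_vertical lam ha).aestronglyMeasurable (ae_of_all _ fun t => ?_)
  have h := norm_mlKernel_le_of_sin_ne_zero lam (s := a + t * I) (by simpa using ha)
  have h' := hC (a + t * I) (by simp) (by simpa using ha1.le)
  have hπ := Real.pi_pos
  simp only [add_re, ofReal_re, mul_re, I_re, mul_zero, ofReal_im, I_im, mul_one, sub_self,
    add_zero, add_im, mul_im, zero_add] at h h'
  refine h.trans ?_
  rw [mul_assoc, ← div_eq_mul_inv]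
  gcongr

theorem integrable_cpow_mul_mlKernel_vertical {lam : ℝ} (h0 : 0 < lam) (h2 : lam < 2) {a : ℝ}
    (ha1 : a < 1) (ha : Real.sin (Real.pi * a) ≠ 0) {x : ℝ} (hx : 0 < x) :
    Integrable fun t : ℝ => (x : ℂ) ^ (-(a + t * I)) * mlKernel lam (a + t * I) := by
  refine (integrable_mlKernel_vertical h0 h2 ha1 ha).bdd_mul (c := Real.exp (|a| * |Real.log x|))
    (Continuous.aestronglyMeasurable ?_) (ae_of_all _ fun t => ?_)
  · exact Continuous.const_cpow (by fun_prop) (Or.inl (by exact_mod_cast hx.ne'))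
  · exact norm_ofReal_cpow_neg_le hx (by simp)

/-! ### The Mittag-Leffler series: convergence and measurability -/

theorem rpow_mul_exp_neg_le_Gamma {A y : ℝ} (hA : 0 < A) (hy : 1 ≤ y) :
    A ^ (y - 1) * Real.exp (-A) ≤ Real.Gamma y := by
  have hint := Real.GammaIntegral_convergent (show 0 < y by linarith)
  rw [Real.Gamma_eq_integral (by linarith), ← integral_exp_neg_Ioi A, ← integral_const_mul]
  -- Euler's integral is cut down to (A, ∞), where t^(y-1) ≥ A^(y-1).
  calc _ ≤ ∫ t in Ioi A, Real.exp (-t) * t ^ (y - 1) := by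
        refine setIntegral_mono_on ((integrableOn_exp_neg_Ioi A).const_mul _)
          (hint.mono_set (Ioi_subset_Ioi hA.le)) measurableSet_Ioi fun t ht => ?_
        rw [mul_comm]
        gcongr
        exact le_of_lt ht
    _ ≤ _ := by
        refine setIntegral_mono_set hint ?_ (Ioi_subset_Ioi hA.le).eventuallyLE
        filter_upwards [ae_restrict_mem measurableSet_Ioi] with t ht
        have : (0 : ℝ) < t := ht
        positivity

/-- With A = (2x)^(1/λ), A^(λu) = (2x)^u, so Γ beats x^u with a factor 2^u to spare. Real u is
needed for the abscissae 1/2 - N. -/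
theorem exists_div_Gamma_le {lam : ℝ} (h0 : 0 < lam) {x : ℝ} (hx : 0 < x) :
    ∃ C : ℝ, 0 ≤ C ∧ ∀ u : ℝ, 0 ≤ u → x ^ u / Real.Gamma (1 + lam * u) ≤ C * (1 / 2) ^ u := by
  set A := (2 * x) ^ (1 / lam) with hA
  have hA0 : 0 < A := by positivity
  refine ⟨Real.exp A, (Real.exp_pos _).le, fun u hu => ?_⟩
  have h := rpow_mul_exp_neg_le_Gamma hA0 (y := 1 + lam * u) (by nlinarith)
  have hG : 0 < Real.Gamma (1 + lam * u) := Real.Gamma_pos_of_pos (by nlinarith)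
  have e : A ^ (1 + lam * u - 1) = 2 ^ u * x ^ u := by
    rw [hA, ← Real.rpow_mul (by positivity), ← Real.mul_rpow (by positivity) hx.le]
    congr 1
    field_simp
    ring
  rw [e, Real.exp_neg, ← div_eq_mul_inv, div_le_iff₀ (Real.exp_pos _)] at h
  rw [div_le_iff₀ hG, Real.div_rpow (by norm_num) (by norm_num), Real.one_rpow]
  have h2 : (0 : ℝ) < 2 ^ u := by positivity
  rw [mul_assoc, one_div_mul_eq_div, mul_div_assoc', le_div_iff₀ h2]
  linarith

theorem summable_mittagLeffler {lam : ℝ} (h0 : 0 < lam) (z : ℂ) :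
    Summable fun n : ℕ => z ^ n / Gamma ((lam : ℂ) * n + 1) := by
  -- Adding 1 keeps the base positive at z = 0.
  obtain ⟨C, hC0, hC⟩ := exists_div_Gamma_le h0 (x := ‖z‖ + 1) (by positivity)
  refine Summable.of_norm_bounded ((summable_geometric_of_lt_one (r := 1 / 2) (by norm_num)
    (by norm_num)).mul_left C) fun n => ?_
  have e : (lam : ℂ) * n + 1 = ((1 + lam * n : ℝ) : ℂ) := by push_cast; ring
  have h := hC n (by positivity)
  rw [Real.rpow_natCast, Real.rpow_natCast] at h
  have hG : 0 < Real.Gamma (1 + lam * n) := Real.Gamma_pos_of_pos (by positivity)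
  rw [norm_div, norm_pow, e, Gamma_ofReal, norm_real, Real.norm_of_nonneg hG.le]
  refine le_trans ?_ h
  gcongr
  linarith

theorem measurable_mittagLeffler {lam : ℝ} (h0 : 0 < lam) : Measurable (mittagLeffler lam) :=
  measurable_of_tendsto_metrizable
    (f := fun (N : ℕ) (z : ℂ) => ∑ n ∈ Finset.range N, z ^ n / Gamma ((lam : ℂ) * n + 1))
    (fun _ => Finset.measurable_fun_sum _ fun n _ => (measurable_id.pow_const n).div_const _)
    (tendsto_pi_nhds.2 fun z => (summable_mittagLeffler h0 z).hasSum.tendsto_sum_nat)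

theorem sin_pi_mul_half_sub_nat (N : ℕ) : |Real.sin (Real.pi * (1 / 2 - N))| = 1 := by
  rw [show Real.pi * (1 / 2 - N) = Real.pi / 2 - N * Real.pi by ring, Real.sin_pi_div_two_sub,
    Real.cos_nat_mul_pi, abs_neg_one_pow]

/-! ### The Mellin–Barnes representation -/

/-- Moving the line of integration from `re s = 1/2 - N` to `re s = 1/2 - (N + 1)`. -/
theorem mlKernel_vertical_integral_step {lam : ℝ} (h0 : 0 < lam) (h2 : lam < 2) {x : ℝ}
    (hx : 0 < x) (N : ℕ) :
    (∫ t : ℝ, (x : ℂ) ^ (-(((1 / 2 - N : ℝ) : ℂ) + t * I)) *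
        mlKernel lam (((1 / 2 - N : ℝ) : ℂ) + t * I)) -
      ∫ t : ℝ, (x : ℂ) ^ (-(((1 / 2 - (N + 1 : ℕ) : ℝ) : ℂ) + t * I)) *
        mlKernel lam (((1 / 2 - (N + 1 : ℕ) : ℝ) : ℂ) + t * I) =
      2 * Real.pi * ((-x : ℂ) ^ N / Gamma ((lam : ℂ) * N + 1)) := by
  have hx' : (x : ℂ) ≠ 0 := by exact_mod_cast hx.ne'
  -- With s = w - N the pole moves to w = 0. There π/sin(πs) = (-1)^N Γ(w)Γ(1-w), and Γ(1+w) = wΓ(w)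
  -- absorbs the pole, leaving F holomorphic for |Re w| < 1.
  set F : ℂ → ℂ := fun w => (-1) ^ N * (x : ℂ) ^ (-(w - N)) *
    (Gamma (1 - lam * (w - N)))⁻¹ * (Gamma (1 + w) * Gamma (1 - w)) with hFdef
  have hFdiv : ∀ w : ℂ, w ≠ 0 → F w / w = (x : ℂ) ^ (-(w - N)) * mlKernel lam (w - N) := by
    intro w hw
    have e1 : Real.pi * (w - N) = Real.pi * w - N * Real.pi := by ring
    have e2 : ((-1 : ℂ) ^ N)⁻¹ = (-1) ^ N := by
      rw [← inv_pow]; norm_num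
    rw [mlKernel_eq_sin, e1, sin_antiperiodic.sub_nat_mul_eq, div_mul_eq_div_div, div_right_comm,
      ← Gamma_mul_Gamma_one_sub, hFdef]
    simp only
    rw [div_eq_mul_inv _ ((-1 : ℂ) ^ N), e2, add_comm 1 w, Gamma_add_one w hw]
    field_simp
  have hne : ∀ (u : ℝ) (t : ℝ), u ≠ 0 → (u : ℂ) + t * I ≠ 0 := fun u t hu h => hu (by
    simpa using congrArg re h)
  have er : ∀ t : ℝ, ((1 / 2 : ℝ) : ℂ) + t * I - N = ((1 / 2 - N : ℝ) : ℂ) + t * I := fun t => by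
    push_cast; ring
  have el : ∀ t : ℝ, ((-(1 / 2) : ℝ) : ℂ) + t * I - N =
      ((1 / 2 - (N + 1 : ℕ) : ℝ) : ℂ) + t * I := fun t => by
    push_cast; ring
  have hr : ∀ t : ℝ, F ((1 / 2 : ℝ) + t * I) / ((1 / 2 : ℝ) + t * I) =
      (x : ℂ) ^ (-(((1 / 2 - N : ℝ) : ℂ) + t * I)) *
        mlKernel lam (((1 / 2 - N : ℝ) : ℂ) + t * I) := fun t => by
    rw [hFdiv _ (hne _ t (by norm_num)), er]
  have hl : ∀ t : ℝ, F ((-(1 / 2) : ℝ) + t * I) / ((-(1 / 2) : ℝ) + t * I) =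
      (x : ℂ) ^ (-(((1 / 2 - (N + 1 : ℕ) : ℝ) : ℂ) + t * I)) *
        mlKernel lam (((1 / 2 - (N + 1 : ℕ) : ℝ) : ℂ) + t * I) := fun t => by
    rw [hFdiv _ (hne _ t (by norm_num)), el]
  have hsin : ∀ M : ℕ, Real.sin (Real.pi * (1 / 2 - M)) ≠ 0 := fun M h => by
    have := sin_pi_mul_half_sub_nat M
    rw [h] at this
    norm_num at this
  have hint : ∀ M : ℕ, Integrable fun t : ℝ => (x : ℂ) ^ (-(((1 / 2 - M : ℝ) : ℂ) + t * I)) *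
        mlKernel lam (((1 / 2 - M : ℝ) : ℂ) + t * I) := fun M =>
    integrable_cpow_mul_mlKernel_vertical h0 h2
      (by linarith [M.cast_nonneg (α := ℝ)]) (hsin M) hx
  obtain ⟨C, hC⟩ := exists_norm_mlKernel_strip_le h0 h2 hx (R := N + 1) (by positivity)
  have hres := vertical_integral_sub_eq_residue (F := F) (C := C) ?_ ?_ ?_ ?_
  · simp only [hr, hl] at hres
    rw [hres]
    have hF0 : F 0 = (-x : ℂ) ^ N / Gamma ((lam : ℂ) * N + 1) := by
      rw [hFdef]
      simp only [zero_sub, neg_neg, cpow_natCast, add_zero, sub_zero, Gamma_one, mul_one]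
      rw [neg_pow (x : ℂ), div_eq_mul_inv]
      congr 3
      ring
    rw [hF0]
  · intro w hw
    have hw' : -1 < w.re ∧ w.re < 1 := hw
    refine DifferentiableAt.differentiableWithinAt ?_
    have hd := (differentiable_inv_Gamma_one_sub lam).comp (f := fun w : ℂ => w - N) (by fun_prop)
    have g1 : DifferentiableAt ℂ (fun w => Gamma (1 + w)) w :=
      (differentiableAt_Gamma _ fun m h => by
        have := congrArg re h
        simp at this
        linarith [m.cast_nonneg (α := ℝ)]).comp w (by fun_prop)
    have g2 : DifferentiableAt ℂ (fun w => Gamma (1 - w)) w :=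
      (differentiableAt_Gamma _ fun m h => by
        have := congrArg re h
        simp at this
        linarith [m.cast_nonneg (α := ℝ)]).comp w (by fun_prop)
    refine (DifferentiableAt.mul ?_ (hd w)).mul (g1.mul g2)
    exact (DifferentiableAt.const_cpow (by fun_prop) (Or.inl hx')).const_mul _
  · intro s hs1 hs2
    have hs0 : s ≠ 0 := by
      rintro rfl
      norm_num at hs2
    have hs1' := abs_le.1 hs1
    have hN := N.cast_nonneg (α := ℝ)
    rw [hFdiv s hs0]
    have := hC (s - N) (by simp; rw [abs_le]; constructor <;> linarith) (by simp; linarith)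
      (by simpa using hs2)
    simpa using this
  · simp only [hr]
    exact hint N
  · simp only [hl]
    exact hint (N + 1)

/-- Half-integer abscissae make |sin(π Re s)| = 1, and keeping Γ(Re(1-λs)) in the denominator gives
x^u/Γ(1+λu) = O(2^{-u}) with u = N - 1/2, times an integrable function of t independent of N. -/
theorem tendsto_mlKernel_vertical_integral {lam : ℝ} (h0 : 0 < lam) (h2 : lam < 2) {x : ℝ}
    (hx : 0 < x) :
    Tendsto (fun N : ℕ => ∫ t : ℝ, (x : ℂ) ^ (-(((1 / 2 - N : ℝ) : ℂ) + t * I)) *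
        mlKernel lam (((1 / 2 - N : ℝ) : ℂ) + t * I)) atTop (𝓝 0) := by
  obtain ⟨C, hC0, hC⟩ := exists_div_Gamma_le h0 hx
  have hπ := Real.pi_pos
  set δ := Real.pi * (1 - lam / 2) with hδ
  have hδ0 : 0 < δ := mul_pos hπ (by linarith)
  set D := 120 * (2 / δ) ^ 5 * Real.exp (1 * δ / 2) with hD
  have hlim : Tendsto (fun N : ℕ => (2 * Real.pi * C * D * (1 / 2) ^ (-(1 / 2) : ℝ) *
      ∫ t : ℝ, (1 + t ^ 2)⁻¹) * (1 / 2 : ℝ) ^ N) atTop (𝓝 0) := by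
    simpa using (tendsto_pow_atTop_nhds_zero_of_lt_one (r := (1 / 2 : ℝ)) (by norm_num)
      (by norm_num)).const_mul _
  refine squeeze_zero_norm' ?_ hlim
  -- N ≥ 1 ensures u ≥ 0 and Re(1 - λs) ≥ 1/2.
  filter_upwards [eventually_ge_atTop 1] with N hN
  have hN' : (1 : ℝ) ≤ N := by exact_mod_cast hN
  rw [mul_right_comm, ← integral_const_mul]
  refine norm_integral_le_of_norm_le (integrable_inv_one_add_sq.const_mul _)
    (ae_of_all _ fun t => ?_)
  have hu : (0 : ℝ) ≤ N - 1 / 2 := by linarith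
  have hre : (((1 / 2 - N : ℝ) : ℂ) + t * I).re = 1 / 2 - N := by simp
  have him : (((1 / 2 - N : ℝ) : ℂ) + t * I).im = t := by simp
  set s := ((1 / 2 - N : ℝ) : ℂ) + t * I with hs
  have k1 := norm_mlKernel_le_of_sin_ne_zero lam (s := s) (by
    rw [hre, ← abs_pos, sin_pi_mul_half_sub_nat]
    norm_num)
  rw [hre, sin_pi_mul_half_sub_nat, him, div_one] at k1
  have gre : (1 - lam * s).re = 1 + lam * (N - 1 / 2) := by
    simp [hre]
    ring
  have gim : |(1 - lam * s).im| = lam * |t| := by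
    simp [him, abs_mul, abs_of_pos h0]
  have k2 := norm_inv_Gamma_le_div (z := 1 - lam * s) (by rw [gre]; nlinarith)
  rw [gre, gim] at k2
  have k3 := hC _ hu
  have k4 := pow_five_mul_exp_neg_le zero_le_one hδ0 (abs_nonneg t)
  have k5 : Real.exp (-(δ * |t|)) ≤ D * (1 + t ^ 2)⁻¹ := by
    rw [← div_eq_mul_inv, le_div_iff₀ (by positivity), mul_comm]
    refine le_trans ?_ k4
    gcongr
    have ht := abs_nonneg t
    calc 1 + t ^ 2 = 1 + |t| ^ 2 := by rw [sq_abs]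
      _ ≤ (1 + 2 * |t|) ^ 2 := by nlinarith
      _ ≤ (1 + 2 * |t|) ^ 5 := pow_le_pow_right₀ (by linarith) (by norm_num)
  have k6 : ‖(x : ℂ) ^ (-s)‖ = x ^ ((N : ℝ) - 1 / 2) := by
    rw [norm_cpow_eq_rpow_re_of_pos hx, neg_re, hre, neg_sub]
  have hG : 0 < Real.Gamma (1 + lam * (N - 1 / 2)) := Real.Gamma_pos_of_pos (by nlinarith)
  rw [norm_mul, k6]
  calc _ ≤ x ^ ((N : ℝ) - 1 / 2) * (2 * Real.pi * (Real.exp (Real.pi / 2 * (lam * |t|)) /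
        Real.Gamma (1 + lam * (N - 1 / 2)) * Real.exp (-(Real.pi * |t|)))) := by
        gcongr
        exact k1.trans (by gcongr)
    _ = 2 * Real.pi * (x ^ ((N : ℝ) - 1 / 2) / Real.Gamma (1 + lam * (N - 1 / 2))) *
        (Real.exp (Real.pi / 2 * (lam * |t|)) * Real.exp (-(Real.pi * |t|))) := by ring
    _ = 2 * Real.pi * (x ^ ((N : ℝ) - 1 / 2) / Real.Gamma (1 + lam * (N - 1 / 2))) *
        Real.exp (-(δ * |t|)) := by rw [← Real.exp_add, hδ]; ring_nf
    _ ≤ 2 * Real.pi * (C * (1 / 2) ^ ((N : ℝ) - 1 / 2)) * (D * (1 + t ^ 2)⁻¹) := by gcongr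
    _ = _ := by
        rw [sub_eq_add_neg, Real.rpow_add (by norm_num), Real.rpow_natCast]
        ring

/-- The Mellin–Barnes representation of the Mittag-Leffler function on the negative axis. -/
theorem mittagLeffler_neg_eq_mellinInv {lam : ℝ} (h0 : 0 < lam) (h2 : lam < 2) {a : ℝ}
    (ha0 : 0 < a) (ha1 : a < 1) {x : ℝ} (hx : 0 < x) :
    mittagLeffler lam (-x) = mellinInv a (mlKernel lam) x := by
  have hsin : ∀ b : ℝ, 0 < b → b < 1 → Real.sin (Real.pi * b) ≠ 0 := fun b hb0 hb1 =>
    (Real.sin_pos_of_pos_of_lt_pi (by have := Real.pi_pos; positivity)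
      (by nlinarith [Real.pi_pos])).ne'
  set J : ℕ → ℂ := fun N => ∫ t : ℝ, (x : ℂ) ^ (-(((1 / 2 - N : ℝ) : ℂ) + t * I)) *
        mlKernel lam (((1 / 2 - N : ℝ) : ℂ) + t * I) with hJ
  -- The residues telescope into partial sums of the series.
  have hsum : ∀ N : ℕ, 2 * Real.pi * ∑ n ∈ Finset.range N,
      (-x : ℂ) ^ n / Gamma ((lam : ℂ) * n + 1) = J 0 - J N := fun N => by
    rw [Finset.mul_sum, ← Finset.sum_range_sub']
    exact Finset.sum_congr rfl fun n _ => (mlKernel_vertical_integral_step h0 h2 hx n).symm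
  have hl1 := ((summable_mittagLeffler h0 (-x)).hasSum.tendsto_sum_nat).const_mul
    (2 * Real.pi : ℂ)
  have hl2 := (tendsto_mlKernel_vertical_integral h0 h2 hx).const_sub (J 0)
  have hmain : 2 * Real.pi * mittagLeffler lam (-x) = J 0 := by
    rw [sub_zero] at hl2
    exact tendsto_nhds_unique hl1 (hl2.congr fun N => (hsum N).symm)
  -- The kernel has no poles in 0 < Re s < 1, so the abscissa 1/2 may be replaced by a.
  have hshift : ∀ b c : ℝ, 0 < b → b ≤ c → c < 1 →
      ∫ t : ℝ, (x : ℂ) ^ (-(c + t * I)) * mlKernel lam (c + t * I) =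
      ∫ t : ℝ, (x : ℂ) ^ (-(b + t * I)) * mlKernel lam (b + t * I) := by
    intro b c hb hbc hc
    obtain ⟨C, hC⟩ := exists_norm_mlKernel_strip_le h0 h2 hx (R := 1) (by positivity)
    refine vertical_integral_eq (f := fun s => (x : ℂ) ^ (-s) * mlKernel lam s) hbc ?_
      (fun s h1 h3 h4 => hC s (abs_le.2 ⟨by linarith, by linarith⟩) (by linarith) h4)
      (integrable_cpow_mul_mlKernel_vertical h0 h2 (by linarith) (hsin b hb (by linarith)) hx)
      (integrable_cpow_mul_mlKernel_vertical h0 h2 hc (hsin c (by linarith) hc) hx)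
    intro s hs
    have hs' : b ≤ s.re ∧ s.re ≤ c := hs
    refine DifferentiableAt.differentiableWithinAt (DifferentiableAt.mul
      (DifferentiableAt.const_cpow (by fun_prop) (Or.inl (by exact_mod_cast hx.ne'))) ?_)
    refine DifferentiableAt.mul (DifferentiableAt.mul ?_ ?_)
      (differentiable_inv_Gamma_one_sub lam s)
    · exact differentiableAt_Gamma _ fun m h => by
        have := congrArg re h
        simp at this
        linarith [m.cast_nonneg (α := ℝ)]
    · exact (differentiableAt_Gamma _ fun m h => by
        have := congrArg re h
        simp at this
        linarith [m.cast_nonneg (α := ℝ)]).comp s (by fun_prop)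
  have hJ0 : J 0 = ∫ t : ℝ, (x : ℂ) ^ (-(a + t * I)) * mlKernel lam (a + t * I) := by
    rw [hJ]
    simp only [Nat.cast_zero, sub_zero]
    rcases le_total a (1 / 2) with h | h
    · exact hshift _ _ ha0 h (by norm_num)
    · exact (hshift _ _ (by norm_num) h ha1).symm
  rw [mellinInv]
  simp only [smul_eq_mul, real_smul]
  rw [← hJ0, ← hmain]
  have : (Real.pi : ℂ) ≠ 0 := by exact_mod_cast Real.pi_ne_zero
  push_cast
  field_simp

/-! ### Mellin convergence and inversion -/

theorem mellinConvergent_of_norm_le {M : ℝ → ℂ} (hM : Measurable M) {a b C D : ℝ} {s : ℂ}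
    (has : a < s.re) (hsb : s.re < b) (ha : ∀ x : ℝ, 0 < x → ‖M x‖ ≤ C * x ^ (-a))
    (hb : ∀ x : ℝ, 0 < x → ‖M x‖ ≤ D * x ^ (-b)) : MellinConvergent M s := by
  have hmeas : Measurable fun t : ℝ => (t : ℂ) ^ (s - 1) • M t := by
    simp only [smul_eq_mul]
    fun_prop
  have key : ∀ (c A : ℝ), (∀ x : ℝ, 0 < x → ‖M x‖ ≤ A * x ^ (-c)) → ∀ x : ℝ, 0 < x →
      ‖(x : ℂ) ^ (s - 1) • M x‖ ≤ A * x ^ (s.re - c - 1) := fun c A h x hx => by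
    rw [norm_smul, norm_cpow_eq_rpow_re_of_pos hx, show s.re - c - 1 = (s - 1).re + -c by
      simp; ring, Real.rpow_add hx]
    have := mul_le_mul_of_nonneg_left (h x hx) (Real.rpow_nonneg hx.le (s - 1).re)
    linarith
  -- The exponent a < Re s serves near 0, and b > Re s near infinity.
  rw [MellinConvergent, ← Ioc_union_Ioi_eq_Ioi zero_le_one]
  refine IntegrableOn.union ?_ ?_
  · have h := (intervalIntegral.intervalIntegrable_rpow' (a := 0) (b := 1)
      (r := s.re - a - 1) (by linarith)).1.const_mul C
    refine h.mono' hmeas.aestronglyMeasurable ?_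
    filter_upwards [ae_restrict_mem measurableSet_Ioc] with x hx using key a C ha x hx.1
  · have h := (integrableOn_Ioi_rpow_of_lt (a := s.re - b - 1) (c := 1) (by linarith)
      zero_lt_one).const_mul D
    refine h.mono' hmeas.aestronglyMeasurable ?_
    filter_upwards [ae_restrict_mem measurableSet_Ioi] with x hx using
      key b D hb x (zero_lt_one.trans hx)

theorem integrable_comp_exp_neg_of_mellinConvergent {f : ℝ → ℂ} {σ : ℝ}
    (hf : MellinConvergent f σ) :
    Integrable fun u : ℝ => (Real.exp (-u) : ℂ) ^ (σ : ℂ) * f (Real.exp (-u)) := by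
  have himg : (fun u : ℝ => Real.exp (-u)) '' univ = Ioi 0 := by
    rw [image_univ]
    ext y
    refine ⟨?_, fun hy => ⟨-Real.log y, ?_⟩⟩
    · rintro ⟨u, rfl⟩
      exact Real.exp_pos _
    · simp [Real.exp_log hy]
  have hder : ∀ u ∈ univ, HasDerivWithinAt (fun u : ℝ => Real.exp (-u)) (-Real.exp (-u)) univ u :=
    fun u _ => by
      have h := (hasDerivAt_neg u).exp
      rw [mul_neg_one] at h
      exact h.hasDerivWithinAt
  have hinj : InjOn (fun u : ℝ => Real.exp (-u)) univ :=
    (Real.exp_injective.comp neg_injective).injOn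
  rw [MellinConvergent, ← himg,
    integrableOn_image_iff_integrableOn_abs_deriv_smul MeasurableSet.univ hder hinj,
    integrableOn_univ] at hf
  refine hf.congr (ae_of_all _ fun u => ?_)
  have h0 : (Real.exp (-u) : ℂ) ≠ 0 := by exact_mod_cast (Real.exp_pos _).ne'
  simp only [abs_neg, abs_of_pos (Real.exp_pos (-u)), real_smul, smul_eq_mul]
  rw [cpow_sub _ _ h0, cpow_one]
  field_simp

/-- The Mellin transform inverts the inverse Mellin transform. -/
theorem mellin_mellinInv_eq {f : ℂ → ℂ} {s : ℂ}
    (hcont : Continuous fun t : ℝ => f (s.re + t * I))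
    (hf : Integrable fun t : ℝ => f (s.re + t * I))
    (hM : MellinConvergent (mellinInv s.re f) s.re) :
    mellin (mellinInv s.re f) s = f s := by
  -- The factor 2π matches the Fourier normalisation; after x = exp(-u) the inverse Mellin transform
  -- is the inverse Fourier transform of h.
  set h : ℝ → ℂ := fun y => f (s.re + 2 * Real.pi * y * I) with hh
  have hrw : h = fun y : ℝ => f (s.re + (2 * Real.pi * y : ℝ) * I) := by
    funext y
    simp [hh]
  have hc : Continuous h := by
    rw [hrw]
    exact hcont.comp (g := fun t : ℝ => f (s.re + t * I)) (by fun_prop)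
  have hi : Integrable h := by
    rw [hrw]
    exact hf.comp_mul_left' (by positivity)
  have hinv : ∀ u : ℝ, (Real.exp (-u) : ℂ) ^ (s.re : ℂ) * mellinInv s.re f (Real.exp (-u)) =
      𝓕⁻ h u := fun u => by
    have h0 : (Real.exp (-u) : ℂ) ≠ 0 := by exact_mod_cast (Real.exp_pos _).ne'
    rw [mellinInv_eq_fourierInv _ _ (Real.exp_pos _), Real.log_exp, neg_neg, smul_eq_mul,
      cpow_neg, mul_inv_cancel_left₀]
    rw [Ne, cpow_eq_zero_iff]
    tauto
  -- Fourier inversion also needs 𝓕 h integrable. It is the reflection of 𝓕⁻ h, whose integrability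
  -- is the assumed Mellin convergence.
  have hFi : Integrable (𝓕 h) := by
    have := (integrable_comp_exp_neg_of_mellinConvergent hM).comp_neg
    simp only [hinv] at this
    refine this.congr (ae_of_all _ fun u => ?_)
    simp [Real.fourierInv_eq_fourier_neg]
  rw [mellin_eq_fourier]
  have hfun : (fun u : ℝ => Real.exp (-s.re * u) • mellinInv s.re f (Real.exp (-u))) = 𝓕⁻ h := by
    funext u
    rw [← hinv, real_smul]
    congr 1
    rw [← ofReal_cpow (Real.exp_pos _).le, ← Real.exp_mul]
    ring_nf
  rw [hfun, hc.fourier_fourierInv_eq hi hFi, hh]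
  have hpi : (Real.pi : ℂ) ≠ 0 := by exact_mod_cast Real.pi_ne_zero
  simp only
  congr 1
  push_cast
  field_simp
  rw [re_add_im]

/-! ### The Mellin transform of the Mittag-Leffler function -/

/-- A measurable function dominated by `x ^ (-re r)` whose Mellin transform at `r` converges
to `K`. -/
structure HasBoundedMellin (M : ℝ → ℂ) (r K : ℂ) : Prop where
  measurable : Measurable M
  convergent : MellinConvergent M r
  mellin_eq : mellin M r = K
  exists_bound : ∃ C : ℝ, ∀ x : ℝ, 0 < x → ‖M x‖ ≤ C * x ^ (-r.re)

theorem exists_norm_mellinInv_le (f : ℂ → ℂ) (a : ℝ) :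
    ∃ C : ℝ, ∀ x : ℝ, 0 < x → ‖mellinInv a f x‖ ≤ C * x ^ (-a) := by
  refine ⟨1 / (2 * Real.pi) * ∫ t : ℝ, ‖f (a + t * I)‖, fun x hx => ?_⟩
  have hπ := Real.pi_pos
  rw [mellinInv, norm_smul, Real.norm_of_nonneg (by positivity), mul_assoc]
  gcongr
  refine (norm_integral_le_integral_norm _).trans (le_of_eq ?_)
  rw [← integral_mul_const]
  refine integral_congr_ae (ae_of_all _ fun t => ?_)
  simp only [norm_smul, norm_cpow_eq_rpow_re_of_pos hx]
  simp [mul_comm]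

theorem measurable_mittagLeffler_neg {lam : ℝ} (h0 : 0 < lam) :
    Measurable fun x : ℝ => mittagLeffler lam (-(x : ℂ)) :=
  (measurable_mittagLeffler h0).comp (by fun_prop)

/-- Mellin–Barnes on two lines flanking Re r gives convergence; on the line Re r itself it gives the
bound and, by inversion, the value. -/
theorem hasBoundedMellin_mittagLeffler {lam : ℝ} (h0 : 0 < lam) (h2 : lam < 2) {r : ℂ}
    (hr0 : 0 < r.re) (hr1 : r.re < 1) :
    HasBoundedMellin (fun x : ℝ => mittagLeffler lam (-(x : ℂ))) r (mlKernel lam r) := by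
  have hbd : ∀ a : ℝ, 0 < a → a < 1 → ∃ C : ℝ, ∀ x : ℝ, 0 < x →
      ‖mittagLeffler lam (-(x : ℂ))‖ ≤ C * x ^ (-a) := fun a ha0 ha1 => by
    obtain ⟨C, hC⟩ := exists_norm_mellinInv_le (mlKernel lam) a
    exact ⟨C, fun x hx => by
      rw [mittagLeffler_neg_eq_mellinInv h0 h2 ha0 ha1 hx]
      exact hC x hx⟩
  obtain ⟨C, hC⟩ := hbd (r.re / 2) (by linarith) (by linarith)
  obtain ⟨D, hD⟩ := hbd ((r.re + 1) / 2) (by linarith) (by linarith)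
  have hconv : ∀ s : ℂ, s.re = r.re →
      MellinConvergent (fun x : ℝ => mittagLeffler lam (-(x : ℂ))) s := fun s hs =>
    mellinConvergent_of_norm_le (measurable_mittagLeffler_neg h0) (by linarith) (by linarith) hC hD
  have heq : EqOn (fun x : ℝ => mittagLeffler lam (-(x : ℂ))) (mellinInv r.re (mlKernel lam))
      (Ioi 0) := fun x hx => mittagLeffler_neg_eq_mellinInv h0 h2 hr0 hr1 hx
  have hsin : Real.sin (Real.pi * r.re) ≠ 0 :=
    (Real.sin_pos_of_pos_of_lt_pi (by have := Real.pi_pos; positivity)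
      (by nlinarith [Real.pi_pos])).ne'
  refine ⟨measurable_mittagLeffler_neg h0, hconv r rfl, ?_, hbd _ hr0 hr1⟩
  rw [← mellin_mellinInv_eq (f := mlKernel lam) (s := r) (continuous_mlKernel_vertical lam hsin)
    (integrable_mlKernel_vertical h0 h2 hr1 hsin)]
  · refine setIntegral_congr_fun measurableSet_Ioi fun x hx => ?_
    simp only
    rw [← heq hx]
  · refine (integrableOn_congr_fun (fun x hx => ?_) measurableSet_Ioi).1 (hconv r.re (ofReal_re _))
    simp only
    rw [← heq hx]

theorem mittagLeffler_one (z : ℂ) : mittagLeffler 1 z = exp z := by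
  rw [mittagLeffler, exp_eq_exp_ℂ, NormedSpace.exp_eq_tsum_div]
  simp [Gamma_nat_eq_factorial]

theorem hasBoundedMellin_mittagLeffler_one {r : ℂ} (hr : 0 < r.re) :
    HasBoundedMellin (fun x : ℝ => mittagLeffler 1 (-(x : ℂ))) r (Gamma r) := by
  have e : ∀ x : ℝ, (x : ℂ) ^ (r - 1) • mittagLeffler 1 (-(x : ℂ)) =
      (Real.exp (-x) : ℂ) * (x : ℂ) ^ (r - 1) := fun x => by
    rw [mittagLeffler_one, smul_eq_mul, mul_comm]
    push_cast
    rfl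
  refine ⟨measurable_mittagLeffler_neg one_pos, ?_, ?_, r.re ^ r.re, fun x hx => ?_⟩
  · rw [MellinConvergent]
    simp only [e]
    exact GammaIntegral_convergent hr
  · rw [mellin, Gamma_eq_integral hr, GammaIntegral]
    simp only [e]
  · rw [mittagLeffler_one, norm_exp, neg_re, ofReal_re, Real.exp_neg, Real.rpow_neg hx.le,
      ← div_eq_mul_inv, le_div_iff₀ (by positivity), inv_mul_le_iff₀ (Real.exp_pos _)]
    -- Raising exp(x/a) ≥ x/a to the power a = Re r gives exp(-x) ≤ a^a x^{-a}.
    have h := Real.add_one_le_exp (x / r.re)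
    have h2 : (x / r.re) ^ r.re ≤ Real.exp (x / r.re) ^ r.re := by
      gcongr
      linarith
    rwa [← Real.exp_mul, div_mul_cancel₀ _ hr.ne', Real.div_rpow hx.le hr.le,
      div_le_iff₀ (by positivity)] at h2

/-! ### Scaling, absolute convergence and Fubini -/

theorem ofReal_rpow_cpow {t : ℝ} (ht : 0 < t) (σ : ℝ) (r : ℂ) :
    ((t ^ σ : ℝ) : ℂ) ^ r = (t : ℂ) ^ (σ * r) := by
  rw [cpow_def_of_ne_zero (by exact_mod_cast (Real.rpow_pos_of_pos ht σ).ne'),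
    cpow_def_of_ne_zero (by exact_mod_cast ht.ne'), ← ofReal_log (by positivity),
    ← ofReal_log ht.le, Real.log_rpow ht]
  push_cast
  ring_nf

theorem HasBoundedMellin.integrableOn_comp_div {M : ℝ → ℂ} {r K : ℂ} (h : HasBoundedMellin M r K)
    {T : ℝ} (hT : 0 < T) : IntegrableOn (fun p : ℝ => (p : ℂ) ^ (r - 1) * M (p / T)) (Ioi 0) := by
  have := (MellinConvergent.comp_mul_left (f := M) (s := r) (inv_pos.2 hT)).2 h.convergent
  simpa [MellinConvergent, div_eq_inv_mul] using this

theorem HasBoundedMellin.integral_comp_div {M : ℝ → ℂ} {r K : ℂ} (h : HasBoundedMellin M r K)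
    {T : ℝ} (hT : 0 < T) : ∫ p in Ioi (0 : ℝ), (p : ℂ) ^ (r - 1) * M (p / T) = (T : ℂ) ^ r * K := by
  have := mellin_comp_mul_left M r (inv_pos.2 hT)
  rw [h.mellin_eq] at this
  simp only [mellin, smul_eq_mul, ← div_eq_inv_mul] at this
  rw [this, ofReal_inv, inv_cpow _ _ (by
    rw [arg_ofReal_of_nonneg hT.le]; exact Real.pi_ne_zero.symm), cpow_neg, inv_inv]

theorem integral_norm_comp_div (M : ℝ → ℂ) (r : ℂ) {T : ℝ} (hT : 0 < T) :
    ∫ p in Ioi (0 : ℝ), ‖(p : ℂ) ^ (r - 1) * M (p / T)‖ =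
      ‖(T : ℂ) ^ r‖ * ∫ p in Ioi (0 : ℝ), ‖(p : ℂ) ^ (r - 1) * M p‖ := by
  have h := integral_comp_mul_left_Ioi (fun p : ℝ => ‖(p : ℂ) ^ (r - 1) * M p‖) 0 (inv_pos.2 hT)
  rw [mul_zero, inv_inv, smul_eq_mul] at h
  rw [norm_cpow_eq_rpow_re_of_pos hT, show r.re = (r - 1).re + 1 by simp, Real.rpow_add_one hT.ne',
    mul_assoc, ← h, ← integral_const_mul]
  refine setIntegral_congr_fun measurableSet_Ioi fun p hp => ?_
  have hp : 0 < p := hp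
  simp only [norm_mul]
  rw [norm_cpow_eq_rpow_re_of_pos hp, norm_cpow_eq_rpow_re_of_pos (by positivity),
    Real.mul_rpow (by positivity) hp.le, Real.inv_rpow hT.le, div_eq_inv_mul]
  field_simp

theorem beta_weight_eq {t : ℝ} (ht : t ∈ Ioo (0 : ℝ) 1) (σ τ : ℝ) (η₁ η₂ r s : ℂ) :
    (t : ℂ) ^ (η₁ - 1) * ((1 - t : ℝ) : ℂ) ^ (η₂ - 1) *
      (((t ^ σ : ℝ) : ℂ) ^ r * (((1 - t) ^ τ : ℝ) : ℂ) ^ s) =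
      (t : ℂ) ^ (η₁ + σ * r - 1) * (1 - (t : ℂ)) ^ (η₂ + τ * s - 1) := by
  have h1 : 0 < 1 - t := by linarith [ht.2]
  rw [ofReal_rpow_cpow ht.1, ofReal_rpow_cpow h1, add_sub_right_comm, add_sub_right_comm,
    cpow_add _ _ (by exact_mod_cast ht.1.ne'), cpow_add _ _ (by
      rw [← ofReal_one, ← ofReal_sub]; exact_mod_cast h1.ne')]
  push_cast
  ring

theorem integrableOn_beta_weight {u v : ℂ} (hu : 0 < u.re) (hv : 0 < v.re) :
    IntegrableOn (fun t : ℝ => (t : ℂ) ^ (u - 1) * (1 - (t : ℂ)) ^ (v - 1)) (Ioo 0 1) :=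
  ((intervalIntegrable_iff_integrableOn_Ioc_of_le zero_le_one).1
    (betaIntegral_convergent hu hv)).mono_set Ioo_subset_Ioc_self

section

variable {M : ℝ → ℂ} {σ τ : ℝ} {η₁ η₂ r s K L : ℂ}

/-- The pointwise bounds on M at p/t^σ and q/(1-t)^τ dominate the integrand by a constant multiple
of the absolute value of the shifted beta weight. -/
theorem integrableOn_extBeta_integrand (hr : HasBoundedMellin M r K) (hs : HasBoundedMellin M s L)
    (hη₁ : 0 < (η₁ + σ * r).re) (hη₂ : 0 < (η₂ + τ * s).re) {p q : ℝ} (hp : 0 < p) (hq : 0 < q) :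
    IntegrableOn (fun t : ℝ => (t : ℂ) ^ (η₁ - 1) * ((1 - t : ℝ) : ℂ) ^ (η₂ - 1) *
      M (p / t ^ σ) * M (q / (1 - t) ^ τ)) (Ioo 0 1) := by
  obtain ⟨C, hC⟩ := hr.exists_bound
  obtain ⟨D, hD⟩ := hs.exists_bound
  have hM := hr.measurable
  refine ((integrableOn_beta_weight hη₁ hη₂).norm.mul_const
    (C * p ^ (-r.re) * (D * q ^ (-s.re)))).mono' ?_ ?_
  · refine Measurable.aestronglyMeasurable ?_
    fun_prop
  · filter_upwards [ae_restrict_mem measurableSet_Ioo] with t ht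
    have h0 : 0 < t := ht.1
    have h1 : 0 < 1 - t := by linarith [ht.2]
    rw [← beta_weight_eq ht]
    have hb : ∀ {u T a A : ℝ} {z : ℂ}, 0 < u → 0 < T → z.re = a → ‖M (u / T)‖ ≤ A * (u / T) ^ (-a) →
        ‖M (u / T)‖ ≤ ‖(T : ℂ) ^ z‖ * (A * u ^ (-a)) := by
      intro u T a A z hu hT hz h
      rw [norm_cpow_eq_rpow_re_of_pos hT, hz]
      refine h.trans (le_of_eq ?_)
      rw [Real.div_rpow hu.le hT.le, Real.rpow_neg hT.le, div_inv_eq_mul]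
      ring
    have k1 := hb hp (Real.rpow_pos_of_pos h0 σ) rfl (hC _ (by positivity))
    have k2 := hb hq (Real.rpow_pos_of_pos h1 τ) rfl (hD _ (by positivity))
    simp only [norm_mul]
    calc _ ≤ ‖(t : ℂ) ^ (η₁ - 1)‖ * ‖((1 - t : ℝ) : ℂ) ^ (η₂ - 1)‖ *
          (‖((t ^ σ : ℝ) : ℂ) ^ r‖ * (C * p ^ (-r.re))) *
          (‖(((1 - t) ^ τ : ℝ) : ℂ) ^ s‖ * (D * q ^ (-s.re))) := by
          gcongr
          exact mul_nonneg (by positivity) ((norm_nonneg _).trans k1)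
      _ = _ := by ring

/-- Tonelli with t outermost: the inner p and q integrals of the norm scale out of t, leaving the
absolute value of the shifted beta weight. -/
theorem integrable_triple (hr : HasBoundedMellin M r K) (hs : HasBoundedMellin M s L)
    (hη₁ : 0 < (η₁ + σ * r).re) (hη₂ : 0 < (η₂ + τ * s).re) :
    Integrable (fun z : (ℝ × ℝ) × ℝ =>
      (z.2 : ℂ) ^ (η₁ - 1) * ((1 - z.2 : ℝ) : ℂ) ^ (η₂ - 1) *
      (((z.1.1 : ℂ) ^ (r - 1) * M (z.1.1 / z.2 ^ σ)) *
        ((z.1.2 : ℂ) ^ (s - 1) * M (z.1.2 / (1 - z.2) ^ τ))))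
      (((volume.restrict (Ioi 0)).prod (volume.restrict (Ioi 0))).prod
        (volume.restrict (Ioo 0 1))) := by
  have hM := hr.measurable
  rw [integrable_prod_iff' (Measurable.aestronglyMeasurable (by fun_prop))]
  constructor
  · filter_upwards [ae_restrict_mem measurableSet_Ioo] with t ht
    have h1 : 0 < 1 - t := by linarith [ht.2]
    exact (Integrable.mul_prod (hr.integrableOn_comp_div (Real.rpow_pos_of_pos ht.1 σ))
      (hs.integrableOn_comp_div (Real.rpow_pos_of_pos h1 τ))).const_mul _
  · refine ((integrableOn_beta_weight hη₁ hη₂).norm.mul_const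
      ((∫ p in Ioi (0 : ℝ), ‖(p : ℂ) ^ (r - 1) * M p‖) *
        ∫ p in Ioi (0 : ℝ), ‖(p : ℂ) ^ (s - 1) * M p‖)).congr ?_
    filter_upwards [ae_restrict_mem measurableSet_Ioo] with t ht
    have h1 : 0 < 1 - t := by linarith [ht.2]
    have e : ∀ x y z : ℂ, ‖x * (y * z)‖ = ‖x‖ * (‖y‖ * ‖z‖) := fun x y z => by
      rw [norm_mul, norm_mul]
    simp only [e ((t : ℂ) ^ (η₁ - 1) * ((1 - t : ℝ) : ℂ) ^ (η₂ - 1))]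
    rw [integral_const_mul, integral_prod_mul (fun p : ℝ => ‖(p : ℂ) ^ (r - 1) * M (p / t ^ σ)‖)
      (fun q : ℝ => ‖(q : ℂ) ^ (s - 1) * M (q / (1 - t) ^ τ)‖),
      integral_norm_comp_div M r (Real.rpow_pos_of_pos ht.1 σ),
      integral_norm_comp_div M s (Real.rpow_pos_of_pos h1 τ), ← beta_weight_eq ht,
      norm_mul _ (_ * _), norm_mul (_ ^ r)]
    ring

theorem double_mellin (hr : HasBoundedMellin M r K) (hs : HasBoundedMellin M s L)
    (hη₁ : 0 < (η₁ + σ * r).re) (hη₂ : 0 < (η₂ + τ * s).re) {B : ℝ → ℝ → ℂ}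
    (hB : ∀ p q, B p q = ∫ t in (0 : ℝ)..1, (t : ℂ) ^ (η₁ - 1) * ((1 - t : ℝ) : ℂ) ^ (η₂ - 1) *
      M (p / t ^ σ) * M (q / (1 - t) ^ τ)) :
    IntegrableOn (fun x : ℝ × ℝ => (x.1 : ℂ) ^ (r - 1) * (x.2 : ℂ) ^ (s - 1) * B x.1 x.2)
      (Ioi 0 ×ˢ Ioi 0) ∧
    ∫ q in Ioi (0 : ℝ), ∫ p in Ioi (0 : ℝ), (p : ℂ) ^ (r - 1) * (q : ℂ) ^ (s - 1) * B p q =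
      K * L * betaIntegral (η₁ + σ * r) (η₂ + τ * s) := by
  have hΦ := integrable_triple hr hs hη₁ hη₂
  have hrw : (fun x : ℝ × ℝ => (x.1 : ℂ) ^ (r - 1) * (x.2 : ℂ) ^ (s - 1) * B x.1 x.2) =
      fun x => ∫ t in Ioo (0 : ℝ) 1, (t : ℂ) ^ (η₁ - 1) * ((1 - t : ℝ) : ℂ) ^ (η₂ - 1) *
      (((x.1 : ℂ) ^ (r - 1) * M (x.1 / t ^ σ)) *
        ((x.2 : ℂ) ^ (s - 1) * M (x.2 / (1 - t) ^ τ))) := by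
    funext x
    rw [hB, intervalIntegral.integral_of_le zero_le_one, integral_Ioc_eq_integral_Ioo,
      ← integral_const_mul]
    congr 1
    funext t
    ring
  have hint := hΦ.integral_prod_left
  rw [← hrw] at hint
  refine ⟨by rwa [IntegrableOn, Measure.volume_eq_prod, ← Measure.prod_restrict], ?_⟩
  rw [← integral_prod_symm _ hint, hrw, integral_integral_swap hΦ, betaIntegral,
    intervalIntegral.integral_of_le zero_le_one, integral_Ioc_eq_integral_Ioo,
    ← integral_const_mul]
  refine setIntegral_congr_fun measurableSet_Ioo fun t ht => ?_
  have h1 : 0 < 1 - t := by linarith [ht.2]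
  rw [integral_const_mul, integral_prod_mul (fun p : ℝ => (p : ℂ) ^ (r - 1) * M (p / t ^ σ))
      (fun q : ℝ => (q : ℂ) ^ (s - 1) * M (q / (1 - t) ^ τ)),
    hr.integral_comp_div (Real.rpow_pos_of_pos ht.1 σ),
    hs.integral_comp_div (Real.rpow_pos_of_pos h1 τ), ← beta_weight_eq ht]
  ring

end

theorem extBetaIntegrand_ofReal (lam σ τ p q : ℝ) (η₁ η₂ : ℂ) (t : ℝ) :
    extBetaIntegrand lam σ τ p q η₁ η₂ t =
      (t : ℂ) ^ (η₁ - 1) * ((1 - t : ℝ) : ℂ) ^ (η₂ - 1) *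
      mittagLeffler lam (-((p / t ^ σ : ℝ) : ℂ)) *
      mittagLeffler lam (-((q / (1 - t) ^ τ : ℝ) : ℂ)) := by
  rw [extBetaIntegrand, neg_div, neg_div, ofReal_div, ofReal_div]

/-! ### The two regimes of λ and the final formula -/

/-- The Mellin transform of `E_lam (-x)`, under the hypotheses of the main theorem. -/
theorem exists_hasBoundedMellin {lam : ℝ} (hlam : 0 < lam) {r : ℂ} (hr : 0 < r.re)
    (h : (lam < 2 ∧ r.re < 1) ∨ lam = 1) :
    ∃ K : ℂ, HasBoundedMellin (fun x : ℝ => mittagLeffler lam (-(x : ℂ))) r K ∧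
      (sin (Real.pi * r) ≠ 0 → K = Real.pi / sin (Real.pi * r) * (Gamma (1 - r * lam))⁻¹) ∧
      (lam = 1 → K = Gamma r) := by
  by_cases h1 : lam = 1
  · subst h1
    refine ⟨Gamma r, hasBoundedMellin_mittagLeffler_one hr, fun hsin => ?_, fun _ => rfl⟩
    rw [← Gamma_mul_Gamma_one_sub, ofReal_one, mul_one, mul_inv_cancel_right₀]
    -- Γ(1-r) = 0 would make π/sin(πr) vanish by reflection, which is impossible when the sine is
    -- nonzero.
    intro h0
    have h2 := Gamma_mul_Gamma_one_sub r
    rw [h0, mul_zero, eq_comm, div_eq_zero_iff] at h2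
    exact h2.elim (fun h => Real.pi_ne_zero (by exact_mod_cast h)) hsin
  · obtain ⟨h2, hr1⟩ := h.resolve_right h1
    exact ⟨_, hasBoundedMellin_mittagLeffler hlam h2 hr hr1,
      fun _ => by rw [mlKernel_eq_sin, mul_comm r], fun h => absurd h h1⟩

end ExtBeta

theorem mainTheorem1 (lam σ τ : ℝ) (η₁ η₂ r s : ℂ)
    (hlam : 0 < lam) (hr : 0 < r.re) (hs : 0 < s.re)
    (hη₁ : 0 < (η₁ + σ * r).re) (hη₂ : 0 < (η₂ + τ * s).re)
    (hconv : (lam < 2 ∧ r.re < 1 ∧ s.re < 1) ∨ lam = 1) :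
    -- the integral defining the extended beta function converges absolutely
    (∀ p q : ℝ, 0 < p → 0 < q →
      IntervalIntegrable (extBetaIntegrand lam σ τ p q η₁ η₂) MeasureTheory.volume 0 1) ∧
    -- the double Mellin integral converges absolutely
    MeasureTheory.IntegrableOn
      (fun x : ℝ × ℝ => (x.1 : ℂ) ^ (r - 1) * (x.2 : ℂ) ^ (s - 1) *
        extBeta lam σ τ x.1 x.2 η₁ η₂)
      (Set.Ioi 0 ×ˢ Set.Ioi 0) MeasureTheory.volume ∧
    -- its value; the sines can vanish only if `lam = 1`, and `1 / Γ` is zero at the poles of `Γ`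
    (Complex.sin (Real.pi * r) ≠ 0 → Complex.sin (Real.pi * s) ≠ 0 →
      ∫ q in Set.Ioi (0 : ℝ), ∫ p in Set.Ioi (0 : ℝ),
          (p : ℂ) ^ (r - 1) * (q : ℂ) ^ (s - 1) * extBeta lam σ τ p q η₁ η₂ =
        (Real.pi : ℂ) ^ 2 /
            (Complex.sin (Real.pi * r) * Complex.sin (Real.pi * s) *
              Complex.Gamma (1 - r * lam) * Complex.Gamma (1 - s * lam)) *
          Complex.betaIntegral (η₁ + σ * r) (η₂ + τ * s)) ∧
    -- for `lam = 1` the factor is `Γ(r) Γ(s)`, which includes the removable integer exponents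
    (lam = 1 →
      ∫ q in Set.Ioi (0 : ℝ), ∫ p in Set.Ioi (0 : ℝ),
          (p : ℂ) ^ (r - 1) * (q : ℂ) ^ (s - 1) * extBeta lam σ τ p q η₁ η₂ =
        Complex.Gamma r * Complex.Gamma s *
          Complex.betaIntegral (η₁ + σ * r) (η₂ + τ * s)) := by
  obtain ⟨K, hK, hKsin, hK1⟩ := ExtBeta.exists_hasBoundedMellin hlam hr
    (hconv.imp_left fun h => ⟨h.1, h.2.1⟩)
  obtain ⟨L, hL, hLsin, hL1⟩ := ExtBeta.exists_hasBoundedMellin hlam hs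
    (hconv.imp_left fun h => ⟨h.1, h.2.2⟩)
  obtain ⟨hint, hval⟩ := ExtBeta.double_mellin hK hL hη₁ hη₂
    (B := fun p q : ℝ => extBeta lam σ τ p q η₁ η₂) (fun p q => by
      simp only [extBeta, ExtBeta.extBetaIntegrand_ofReal])
  refine ⟨fun p q hp hq => ?_, hint, fun hsr hss => ?_, fun h1 => ?_⟩
  · rw [intervalIntegrable_iff_integrableOn_Ioo_of_le zero_le_one]
    refine (ExtBeta.integrableOn_extBeta_integrand hK hL hη₁ hη₂ hp hq).congr
      (Filter.Eventually.of_forall fun t => ?_)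
    exact (ExtBeta.extBetaIntegrand_ofReal lam σ τ p q η₁ η₂ t).symm
  · rw [hval, hKsin hsr, hLsin hss]
    -- Splitting the inverse needs no nonvanishing: at a pole of Γ both sides carry `0⁻¹ = 0`, the
    -- stated convention for 1/Γ.
    simp only [div_eq_mul_inv, mul_inv]
    ring
  · rw [hval, hK1 h1, hL1 h1]
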